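/- Let $G=(V,E)$ be a finite directed graph (parallel edges allowed), $I$ a finite set of commodities with sources $s_i$, sinks $t_i$ and demands $d_i>0$, $\mathcal P_i$ the set of simple $s_i$-$t_i$-paths, and $\mathcal P=\{(i,p): i\in I, p\in\mathcal P_i\}$. Let $\mathcal F=\{x\in\mathbb R^{\mathcal P}_{\ge 0}:\sum_{p\in\mathcal P_i}x_{i,p}=d_i \text{ for all } i\in I\}$ be the set of feasible flows, $J$ a finite set of externality classes, $\tau_{i,p}:\mathcal F\to\mathbb R$ travel times, $g_{i,p,j}:\mathcal F\to\mathbb R_{\ge 0}$ externality functions, and $G_j(x)=\sum_{(i,p)\in\mathcal P}g_{i,p,j}(x)\,x_{i,p}$. For prices $\lambda\in\mathbb R^J_{\ge0}$ let $c^\lambda_{i,p}=\tau_{i,p}+\sum_{j}\lambda_j g_{i,p,j}$; a flow $x\in\mathcal F$ is a Wardrop equilibrium for $\lambda$, written $x\in\mathrm{WE}(\lambda)$, if $x_{i,p}>0$ implies $c^\lambda_{i,p}(x)\le c^\lambda_{i,q}(x)$ for all $i\in I$ and $p,q\in\mathcal P_i$. A flow $x$ respects $B\in\mathbb R_{\ge0}^J$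 if $G_j(x)\le B_j$ for all $j$; $B$ is feasible if some $x\in\mathcal F$ respects it; $x$ is implementable if $x\in\mathrm{WE}(\lambda)$ for some $\lambda\in\mathbb R^J_{\ge0}$; and $B$ is implementable if some implementable flow respects $B$. **Theorem.** Assume that $\tau$ and $g$ have convex potentials, that is, there are differentiable convex functions $\Phi,\Psi_j:\mathbb R^{\mathcal P}\to\mathbb R$ $(j\in J)$ with $\tau_{i,p}(x)=\partial\Phi/\partial x_{i,p}(x)$ and $g_{i,p,j}(x)=\partial\Psi_j/\partial x_{i,p}(x)$ for all $x\in\mathcal F$ and $(i,p)\in\mathcal P$. Let $B\in\mathbb R^J_{\ge0}$ be a feasible budget vector. For every $j\in J$ there is a minimal number $\gamma_j\in\mathbb R$ such that $G_j(x)\le\Psi_j(x)+\gamma_j$ for all $x\in\mathcal F$. Consider the convex program $$\text{(P)}\qquad \min_{x\in\mathcal F}\ \Phi(x)\quad\text{s.t.}\quad \Psi_j(x)+\gamma_j\le B_j\ \text{ for all } j\in J .$$ 1. Every optimal solution $x$ of (P) respects $B$, and whenever $\lambda$ is a vector of optimal Lagrange multipliers of the externality constraints at $x$ (that is, $\lambda\in\mathbb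 R^J_{\ge0}$ is the corresponding part of a tuple $(x,\lambda,\mu,\nu)$ satisfying the Karush–Kuhn–Tucker conditions of (P), with $\mu$ the multipliers of the non-negativity constraints and $\nu$ those of the demand constraints), then $x\in\mathrm{WE}(\lambda)$. 2. Suppose in addition that (P) satisfies Slater's constraint qualification: there is a point $y\in\mathcal F$ feasible for (P) with $\Psi_j(y)+\gamma_j<B_j$ for every $j\in J$ for which $\Psi_j$ does not coincide on $\mathcal F$ with an affine function. (If all $g_{i,p,j}$ are constant on $\mathcal F$, this only says that (P) is feasible.) Then every optimal solution of (P) has optimal Lagrange multipliers of the externality constraints and hence is implementable via them; and $B$ is implementable if (P) admits an optimal solution. -/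

import Mathlib

open scoped BigOperators

namespace Traffic

universe u v w z

/-- The simple directed paths from `a` to `b` in a directed (multi)graph, given as a quiver:
the directed paths that visit no vertex twice. -/
def SimplePath {V : Type u} [Quiver.{v} V] (a b : V) : Type (max u v) :=
  {p : Quiver.Path a b // p.vertices.Nodup}

/-- In a finite directed graph there are finitely many directed paths of a given length. -/
theorem finite_path_length_eq {V : Type u} [Quiver.{v} V] [Finite V]
    [∀ a b : V, Finite (a ⟶ b)] (a : V) (n : ℕ) :
    ∀ b : V, Finite {p : Quiver.Path a b // p.length = n} := by
  induction n with
  | zero =>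
    intro b
    have : Subsingleton {p : Quiver.Path a b // p.length = 0} := by
      refine ⟨?_⟩
      rintro ⟨p, hp⟩ ⟨q, hq⟩
      apply Subtype.ext
      have hab := p.eq_of_length_zero hp
      subst hab
      exact (p.eq_nil_of_length_zero hp).trans (q.eq_nil_of_length_zero hq).symm
    infer_instance
  | succ n ih =>
    intro b
    let f : (Σ c : V, {p : Quiver.Path a c // p.length = n} × (c ⟶ b)) →
        {p : Quiver.Path a b // p.length = n + 1} :=
      fun t => ⟨t.2.1.1.cons t.2.2, by rw [Quiver.Path.length_cons, t.2.1.2]⟩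
    refine Finite.of_surjective f ?_
    rintro ⟨p, hp⟩
    cases p with
    | nil => simp at hp
    | cons p e =>
      rw [Quiver.Path.length_cons] at hp
      exact ⟨⟨_, ⟨p, Nat.succ.inj hp⟩, e⟩, rfl⟩

/-- A finite directed graph has finitely many simple paths between two vertices. -/
instance finite_simplePath {V : Type u} [Quiver.{v} V] [Finite V]
    [∀ a b : V, Finite (a ⟶ b)] (a b : V) : Finite (SimplePath a b) := by
  have hfin : ∀ n : ℕ, Finite {p : Quiver.Path a b // p.length = n} :=
    fun n => finite_path_length_eq a n b
  have hlen : ∀ p : SimplePath a b, p.1.length < Nat.card V + 1 := by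
    intro p
    have : Fintype V := Fintype.ofFinite V
    have h := p.2.length_le_card
    rw [Quiver.Path.vertices_length] at h
    rw [Nat.card_eq_fintype_card]
    omega
  let f : SimplePath a b →
      Σ n : Fin (Nat.card V + 1), {p : Quiver.Path a b // p.length = n.1} :=
    fun p => ⟨⟨p.1.length, hlen p⟩, ⟨p.1, rfl⟩⟩
  refine Finite.of_injective f ?_
  intro p q h
  have h' := congrArg (fun t : Σ n : Fin (Nat.card V + 1),
    {p : Quiver.Path a b // p.length = n.1} => t.2.1) h
  exact Subtype.ext h'

noncomputable instance fintypeSimplePath {V : Type u} [Quiver.{v} V] [Finite V]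
    [∀ a b : V, Finite (a ⟶ b)] (a b : V) : Fintype (SimplePath a b) :=
  Fintype.ofFinite _

/-- Commodities `i : I` in a directed graph on `V`, with source, sink and demand `> 0`. -/
structure Commodities (V : Type u) (I : Type w) where
  source : I → V
  sink : I → V
  demand : I → ℝ
  demand_pos : ∀ i, 0 < demand i

namespace Commodities

variable {V : Type u} [Quiver.{v} V] {I : Type w} {J : Type z}

/-- The pairs `(i, p)` of a commodity `i` and a simple path `p` from its source to its sink. -/
abbrev PathIndex (N : Commodities V I) : Type (max u v w) :=
  Σ i : I, SimplePath (N.source i) (N.sink i)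

variable [Finite V] [∀ a b : V, Finite (a ⟶ b)] [Fintype I] [Fintype J]

/-- The set of feasible flows. -/
def feasibleFlows (N : Commodities V I) : Set (N.PathIndex → ℝ) :=
  {x | (∀ q, 0 ≤ x q) ∧
    ∀ i, ∑ p : SimplePath (N.source i) (N.sink i), x ⟨i, p⟩ = N.demand i}

/-- Total externality `G_j(x) = ∑_{(i,p)} g_{i,p,j}(x) x_{i,p}` of class `j`. -/
noncomputable def totalExternality (N : Commodities V I)
    (g : N.feasibleFlows → N.PathIndex → J → ℝ) (j : J) (x : N.feasibleFlows) : ℝ :=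
  ∑ q : N.PathIndex, g x q j * x.1 q

/-- The flow `x` is a Wardrop equilibrium with respect to the cost function `c`. -/
def IsWardropEquilibrium (N : Commodities V I)
    (c : N.feasibleFlows → N.PathIndex → ℝ) (x : N.feasibleFlows) : Prop :=
  ∀ (i : I) (p : SimplePath (N.source i) (N.sink i)), 0 < x.1 ⟨i, p⟩ →
    ∀ q : SimplePath (N.source i) (N.sink i), c x ⟨i, p⟩ ≤ c x ⟨i, q⟩

/-- Effective cost `τ_{i,p}(x) + ∑_j λ_j g_{i,p,j}(x)` under the prices `lam`. -/
noncomputable def effectiveCost (N : Commodities V I)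
    (τ : N.feasibleFlows → N.PathIndex → ℝ) (g : N.feasibleFlows → N.PathIndex → J → ℝ)
    (lam : J → ℝ) : N.feasibleFlows → N.PathIndex → ℝ :=
  fun x q => τ x q + ∑ j, lam j * g x q j

/-- The set of Wardrop equilibria for the prices `lam`. -/
def WE (N : Commodities V I)
    (τ : N.feasibleFlows → N.PathIndex → ℝ) (g : N.feasibleFlows → N.PathIndex → J → ℝ)
    (lam : J → ℝ) : Set N.feasibleFlows :=
  {x | N.IsWardropEquilibrium (N.effectiveCost τ g lam) x}

/-- The flow `x` respects the budget vector `B`. -/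
def Respects (N : Commodities V I) (g : N.feasibleFlows → N.PathIndex → J → ℝ)
    (B : J → ℝ) (x : N.feasibleFlows) : Prop :=
  ∀ j, N.totalExternality g j x ≤ B j

/-- The budget vector `B` is feasible: some feasible flow respects it. -/
def IsFeasibleBudget (N : Commodities V I) (g : N.feasibleFlows → N.PathIndex → J → ℝ)
    (B : J → ℝ) : Prop :=
  ∃ x : N.feasibleFlows, N.Respects g B x

/-- The flow `x` is implementable: it is an equilibrium for some nonnegative prices. -/
def IsImplementableFlow (N : Commodities V I)
    (τ : N.feasibleFlows → N.PathIndex → ℝ) (g : N.feasibleFlows → N.PathIndex → J → ℝ)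
    (x : N.feasibleFlows) : Prop :=
  ∃ lam : J → ℝ, (∀ j, 0 ≤ lam j) ∧ x ∈ N.WE τ g lam

/-- The budget vector `B` is implementable: some implementable flow respects it. -/
def IsImplementableBudget (N : Commodities V I)
    (τ : N.feasibleFlows → N.PathIndex → ℝ) (g : N.feasibleFlows → N.PathIndex → J → ℝ)
    (B : J → ℝ) : Prop :=
  ∃ x : N.feasibleFlows, N.IsImplementableFlow τ g x ∧ N.Respects g B x

open Classical in
/-- The partial derivative of `Φ` at `x` in the coordinate `q`. -/
noncomputable def partialDeriv (N : Commodities V I) (Φ : (N.PathIndex → ℝ) → ℝ)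
    (x : N.PathIndex → ℝ) (q : N.PathIndex) : ℝ :=
  fderiv ℝ Φ x (Pi.single q 1)

/-- `Φ` is a convex potential of the cost function `c`: a differentiable convex function on
the whole space whose gradient is `c` at every feasible flow. -/
structure IsConvexPotential (N : Commodities V I)
    (c : N.feasibleFlows → N.PathIndex → ℝ) (Φ : (N.PathIndex → ℝ) → ℝ) : Prop where
  differentiable : Differentiable ℝ Φ
  convex : ConvexOn ℝ Set.univ Φ
  eq_partialDeriv : ∀ (x : N.feasibleFlows) (q : N.PathIndex), c x q = N.partialDeriv Φ x.1 q

/-- `γ_j` is the minimal real number with `G_j(x) ≤ Ψ_j(x) + γ_j` for all feasible flows `x`. -/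
def IsMinimalGap (N : Commodities V I) (g : N.feasibleFlows → N.PathIndex → J → ℝ)
    (Ψ : J → (N.PathIndex → ℝ) → ℝ) (γ : J → ℝ) : Prop :=
  ∀ j, IsLeast {c : ℝ | ∀ x : N.feasibleFlows, N.totalExternality g j x ≤ Ψ j x.1 + c} (γ j)

/-- The feasible flow `x` satisfies the externality constraints `Ψ_j(x) + γ_j ≤ B_j`. -/
def IsProgramFeasible (N : Commodities V I) (Ψ : J → (N.PathIndex → ℝ) → ℝ) (γ B : J → ℝ)
    (x : N.feasibleFlows) : Prop :=
  ∀ j, Ψ j x.1 + γ j ≤ B j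

/-- `x` is an optimal solution of: minimise `Φ(x)` over the feasible flows `x` subject to
`Ψ_j(x) + γ_j ≤ B_j` for all `j`. -/
def IsProgramOptimal (N : Commodities V I) (Φ : (N.PathIndex → ℝ) → ℝ)
    (Ψ : J → (N.PathIndex → ℝ) → ℝ) (γ B : J → ℝ) (x : N.feasibleFlows) : Prop :=
  N.IsProgramFeasible Ψ γ B x ∧
    ∀ y : N.feasibleFlows, N.IsProgramFeasible Ψ γ B y → Φ x.1 ≤ Φ y.1

/-- The Karush-Kuhn-Tucker conditions of the program at the feasible point `x`, with multipliers
`lam` of the externality constraints, `mu` of the constraints `x_{i,p} ≥ 0`, and `nu` of the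
demand constraints. -/
structure IsKKT (N : Commodities V I) (Φ : (N.PathIndex → ℝ) → ℝ)
    (Ψ : J → (N.PathIndex → ℝ) → ℝ) (γ B : J → ℝ) (x : N.feasibleFlows)
    (lam : J → ℝ) (mu : N.PathIndex → ℝ) (nu : I → ℝ) : Prop where
  primal : N.IsProgramFeasible Ψ γ B x
  lam_nonneg : ∀ j, 0 ≤ lam j
  mu_nonneg : ∀ q, 0 ≤ mu q
  lam_slack : ∀ j, lam j * (Ψ j x.1 + γ j - B j) = 0
  mu_slack : ∀ q, mu q * x.1 q = 0
  stationary : ∀ q, N.partialDeriv Φ x.1 q + ∑ j, lam j * N.partialDeriv (Ψ j) x.1 q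
    - mu q + nu q.1 = 0

/-- `lam` is a vector of optimal Lagrange multipliers of the externality constraints at `x`. -/
def IsLagrangeMultiplier (N : Commodities V I) (Φ : (N.PathIndex → ℝ) → ℝ)
    (Ψ : J → (N.PathIndex → ℝ) → ℝ) (γ B : J → ℝ) (x : N.feasibleFlows) (lam : J → ℝ) : Prop :=
  ∃ (mu : N.PathIndex → ℝ) (nu : I → ℝ), N.IsKKT Φ Ψ γ B x lam mu nu

/-- The function `f` agrees with an affine function on the feasible flows. -/
def IsAffineOnFlows (N : Commodities V I) (f : (N.PathIndex → ℝ) → ℝ) : Prop :=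
  ∃ (a : N.PathIndex → ℝ) (b : ℝ), ∀ x : N.feasibleFlows, f x.1 = ∑ q, a q * x.1 q + b

/-- Slater's constraint qualification in its usual form, strictness being required only for the
constraints that are not affine. -/
def SlaterCondition (N : Commodities V I) (Ψ : J → (N.PathIndex → ℝ) → ℝ)
    (γ B : J → ℝ) : Prop :=
  ∃ y : N.feasibleFlows, N.IsProgramFeasible Ψ γ B y ∧
    ∀ j, ¬ N.IsAffineOnFlows (Ψ j) → Ψ j y.1 + γ j < B j

end Commodities

end Traffic

/-! Stationarity in the KKT system says that the effective cost of (i,p) is `mu (i,p) - nu i`. Since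
`mu ≥ 0` vanishes on used paths, these are cheapest for their commodity, which is the Wardrop
condition. Budgets are respected because `γ` is chosen so that `Ψ j + γ j` dominates the total
externality; it exists because convexity bounds the gap on the compact flow polytope. Multipliers
come from Farkas' lemma applied to the linearised active constraints. It needs `Φ` not to decrease
to first order along any direction satisfying them. Optimality gives this directly only when the
active non-affine constraints strictly decrease; tilting the direction slightly towards a Slater
point gains that strictness, and the tilt then tends to 0. -/

open Filter Topology

/-! ### Linear algebra: Farkas' lemma by induction on the number of forms -/

/-- **Farkas' lemma**: a linear form that is nonpositive wherever finitely many linear forms are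
nonpositive is a nonnegative combination of them. -/
theorem exists_nonneg_sum_smul_of_forall_nonpos {W ι : Type*} [AddCommGroup W] [Module ℝ W]
    (s : Finset ι) : ∀ (a : ι → W →ₗ[ℝ] ℝ) (b : W →ₗ[ℝ] ℝ),
    (∀ w, (∀ j ∈ s, a j w ≤ 0) → b w ≤ 0) →
    ∃ l : ι → ℝ, (∀ j, 0 ≤ l j) ∧ b = ∑ j ∈ s, l j • a j := by
  classical
  induction s using Finset.induction_on with
  | empty =>
    intro a b h
    refine ⟨0, fun _ => le_rfl, ?_⟩
    ext w
    have h1 := h w (by simp)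
    have h2 := h (-w) (by simp)
    rw [map_neg] at h2
    simp only [Finset.sum_empty, LinearMap.zero_apply]
    linarith
  | insert k s hk ih =>
    intro a b h
    by_cases hs : ∀ w, (∀ j ∈ s, a j w ≤ 0) → b w ≤ 0
    · obtain ⟨l, hl, hb⟩ := ih a b hs
      refine ⟨Function.update l k 0, fun j => ?_, ?_⟩
      · by_cases hj : j = k
        · subst hj; simp
        · simpa [hj] using hl j
      · rw [Finset.sum_insert hk, hb]
        simp only [Function.update_self, zero_smul, zero_add]
        refine Finset.sum_congr rfl fun j hj => ?_
        rw [Function.update_of_ne (ne_of_mem_of_not_mem hj hk)]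
    · push Not at hs
      obtain ⟨v, hv, hbv⟩ := hs
      have hav : 0 < a k v := by
        by_contra hc
        refine absurd (h v fun j hj => ?_) (not_le.mpr hbv)
        rcases Finset.mem_insert.mp hj with rfl | hj
        · exact not_lt.mp hc
        · exact hv j hj
      -- These are the old forms composed with the projection `w ↦ w - (a k w / a k v) • v` onto the
      -- kernel of `a k` along `v`, where the constraint `k` holds trivially.
      obtain ⟨l, hl, hb⟩ := ih (fun j => a j - (a j v / a k v) • a k)
        (b - (b v / a k v) • a k) (fun w hw => by
          have h1 := h (w - (a k w / a k v) • v) (fun j hj => by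
            rcases Finset.mem_insert.mp hj with rfl | hj
            · simp [div_mul_cancel₀ _ hav.ne']
            · have := hw j hj
              simp only [LinearMap.sub_apply, LinearMap.smul_apply, smul_eq_mul, map_sub,
                map_smul] at this ⊢
              convert this using 2
              ring)
          simp only [LinearMap.sub_apply, LinearMap.smul_apply, smul_eq_mul, map_sub,
            map_smul] at h1 ⊢
          convert h1 using 2
          ring)
      -- Unfolding the projections leaves this coefficient on `a k`; it is nonnegative because `b v
      -- > 0`, `a k v > 0` and every other `a j v ≤ 0`.
      refine ⟨Function.update l k ((b v - ∑ j ∈ s, l j * a j v) / a k v), fun j => ?_, ?_⟩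
      · by_cases hj : j = k
        · subst hj
          rw [Function.update_self]
          refine div_nonneg ?_ hav.le
          have : ∑ j ∈ s, l j * a j v ≤ 0 :=
            Finset.sum_nonpos fun j hj => mul_nonpos_of_nonneg_of_nonpos (hl j) (hv j hj)
          linarith
        · simpa [hj] using hl j
      · have hsum : ∑ j ∈ s, Function.update l k ((b v - ∑ j ∈ s, l j * a j v) / a k v) j • a j
            = ∑ j ∈ s, l j • a j := Finset.sum_congr rfl fun j hj => by
          rw [Function.update_of_ne (ne_of_mem_of_not_mem hj hk)]
        rw [Finset.sum_insert hk, hsum, Function.update_self]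
        ext w
        have hw := congrArg (fun f : W →ₗ[ℝ] ℝ => f w) hb
        simp only [LinearMap.sub_apply, LinearMap.smul_apply, smul_eq_mul, LinearMap.add_apply,
          LinearMap.sum_apply, mul_sub, Finset.sum_sub_distrib] at hw ⊢
        have h3 : ∑ j ∈ s, l j * (a j v / a k v * a k w)
            = (∑ j ∈ s, l j * a j v) / a k v * a k w := by
          rw [Finset.sum_div, Finset.sum_mul]
          exact Finset.sum_congr rfl fun j _ => by ring
        rw [h3] at hw
        rw [sub_div, sub_mul]
        linarith

/-! ### Convexity and first-order behaviour along lines -/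

section Calculus

variable {E : Type*} [NormedAddCommGroup E] [NormedSpace ℝ E] {f : E → ℝ}

theorem hasDerivAt_comp_line {x z : E} (hf : DifferentiableAt ℝ f x) :
    HasDerivAt (fun t : ℝ => f (x + t • z)) (fderiv ℝ f x z) 0 := by
  have h1 : HasDerivAt (fun t : ℝ => x + t • z) z 0 := by
    simpa using ((hasDerivAt_id (0 : ℝ)).smul_const z).const_add x
  have h2 : HasFDerivAt f (fderiv ℝ f x) (x + (0 : ℝ) • z) := by simpa using hf.hasFDerivAt
  exact h2.comp_hasDerivAt (0 : ℝ) h1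

/-- A differentiable convex function lies above its tangents. -/
theorem fderiv_le_sub_of_convexOn (hc : ConvexOn ℝ Set.univ f) {x : E}
    (hf : DifferentiableAt ℝ f x) (z : E) : fderiv ℝ f x z ≤ f (x + z) - f x := by
  have hline : ConvexOn ℝ Set.univ (fun t : ℝ => f (x + t • z)) := by
    have := hc.comp_affineMap (AffineMap.lineMap x (x + z))
    simpa [Function.comp_def, AffineMap.lineMap_apply, add_comm] using this
  have := hline.le_slope_of_hasDerivAt (Set.mem_univ 0) (Set.mem_univ 1) one_pos
    (hasDerivAt_comp_line hf)
  simpa [slope_def_field] using this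

theorem eventually_lt_of_fderiv_neg {x z : E} (hf : DifferentiableAt ℝ f x)
    (hz : fderiv ℝ f x z < 0) : ∀ᶠ ε in 𝓝[>] (0 : ℝ), f (x + ε • z) < f x := by
  have h := (hasDerivAt_iff_tendsto_slope.mp (hasDerivAt_comp_line (z := z) hf)).mono_left
    (nhdsWithin_mono (0 : ℝ) (fun t (ht : t ∈ Set.Ioi (0 : ℝ)) => (ne_of_gt ht : t ≠ 0)))
  filter_upwards [h.eventually_lt_const hz, self_mem_nhdsWithin] with ε hε hpos
  have hpos : 0 < ε := hpos
  simp only [slope_def_field, sub_zero, zero_smul, add_zero] at hε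
  rw [div_lt_iff₀ hpos, zero_mul] at hε
  linarith

theorem eventually_lt_of_lt {x z : E} (hf : Continuous f) {c : ℝ} (hc : f x < c) :
    ∀ᶠ ε in 𝓝[>] (0 : ℝ), f (x + ε • z) < c := by
  have h : Continuous fun ε : ℝ => f (x + ε • z) := by fun_prop
  have h0 : Tendsto (fun ε : ℝ => f (x + ε • z)) (𝓝 0) (𝓝 (f x)) := by simpa using h.tendsto 0
  exact nhdsWithin_le_nhds (h0.eventually_lt_const hc)

end Calculus

/-! ### The flow polytope, equilibria from multipliers, and the constants `γ` -/

namespace Traffic.Commodities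

variable {V : Type*} [Quiver V] {I : Type*} {J : Type*}
  [Finite V] [∀ a b : V, Finite (a ⟶ b)] {N : Commodities V I}

theorem isCompact_feasibleFlows : IsCompact N.feasibleFlows := by
  refine (isCompact_univ_pi (s := fun q : N.PathIndex => Set.Icc 0 (N.demand q.1))
    fun _ => isCompact_Icc).of_isClosed_subset ?_ ?_
  · have : N.feasibleFlows = (⋂ q, {x | 0 ≤ x q}) ∩
        ⋂ i, {x | ∑ p : SimplePath (N.source i) (N.sink i), x ⟨i, p⟩ = N.demand i} := by
      ext x; simp [feasibleFlows]
    rw [this]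
    refine (isClosed_iInter fun q => isClosed_le (by fun_prop) (by fun_prop)).inter
      (isClosed_iInter fun i => isClosed_eq (by fun_prop) (by fun_prop))
  · rintro x ⟨h0, hd⟩ ⟨i, p⟩ -
    refine ⟨h0 _, ?_⟩
    rw [← hd i]
    exact Finset.single_le_sum (f := fun p => x ⟨i, p⟩) (fun r _ => h0 ⟨i, r⟩)
      (Finset.mem_univ p)

theorem convex_feasibleFlows : Convex ℝ N.feasibleFlows := by
  rintro x ⟨hx0, hx⟩ y ⟨hy0, hy⟩ a b ha hb hab
  refine ⟨fun q => ?_, fun i => ?_⟩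
  · simp only [Pi.add_apply, Pi.smul_apply, smul_eq_mul]
    have := hx0 q
    have := hy0 q
    positivity
  · simp only [Pi.add_apply, Pi.smul_apply, smul_eq_mul, Finset.sum_add_distrib,
      ← Finset.mul_sum, hx, hy, ← add_mul, hab, one_mul]

theorem IsLagrangeMultiplier.mem_WE [Fintype J] {τ : N.feasibleFlows → N.PathIndex → ℝ}
    {g : N.feasibleFlows → N.PathIndex → J → ℝ} {Φ : (N.PathIndex → ℝ) → ℝ}
    {Ψ : J → (N.PathIndex → ℝ) → ℝ} (hΦ : N.IsConvexPotential τ Φ)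
    (hΨ : ∀ j, N.IsConvexPotential (fun x q => g x q j) (Ψ j)) {γ B : J → ℝ}
    {x : N.feasibleFlows} {lam : J → ℝ} (h : N.IsLagrangeMultiplier Φ Ψ γ B x lam) :
    x ∈ N.WE τ g lam := by
  obtain ⟨mu, nu, hk⟩ := h
  have hcost : ∀ q, N.effectiveCost τ g lam x q = mu q - nu q.1 := by
    intro q
    have h1 := hk.stationary q
    have h2 : ∑ j, lam j * g x q j = ∑ j, lam j * N.partialDeriv (Ψ j) x.1 q :=
      Finset.sum_congr rfl fun j _ => by rw [← (hΨ j).eq_partialDeriv x q]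
    rw [effectiveCost, hΦ.eq_partialDeriv, h2]
    linarith
  intro i p hp q
  have hmu : mu ⟨i, p⟩ = 0 := (mul_eq_zero.mp (hk.mu_slack ⟨i, p⟩)).resolve_right hp.ne'
  rw [hcost, hcost, hmu]
  have := hk.mu_nonneg ⟨i, q⟩
  dsimp only
  linarith

variable [Fintype I]

theorem fderiv_apply_eq_sum_partialDeriv (f : (N.PathIndex → ℝ) → ℝ) (x w : N.PathIndex → ℝ) :
    fderiv ℝ f x w = ∑ q, N.partialDeriv f x q * w q := by
  classical
  conv_lhs => rw [pi_eq_sum_univ' w, map_sum]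
  refine Finset.sum_congr rfl fun q _ => ?_
  rw [map_smul, smul_eq_mul, mul_comm]
  unfold partialDeriv
  congr 2

/-- The least constant is the supremum of `G_j - Ψ_j`, so only boundedness above is at stake; no
continuity of `g` is needed for it. -/
theorem exists_isMinimalGap (hne : Nonempty N.feasibleFlows)
    {g : N.feasibleFlows → N.PathIndex → J → ℝ} {Ψ : J → (N.PathIndex → ℝ) → ℝ}
    (hΨ : ∀ j, N.IsConvexPotential (fun x q => g x q j) (Ψ j)) :
    ∃ γ : J → ℝ, N.IsMinimalGap g Ψ γ := by
  have key : ∀ j, ∃ c, IsLeast {c : ℝ | ∀ x : N.feasibleFlows,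
      N.totalExternality g j x ≤ Ψ j x.1 + c} c := by
    intro j
    set h : N.feasibleFlows → ℝ := fun x => N.totalExternality g j x - Ψ j x.1
    have hbdd : BddAbove (Set.range h) := by
      -- Since `G_j(x)` is the derivative of `Ψ j` at `x` in the direction `x` itself, the tangent
      -- inequality gives `G_j(x) ≤ Ψ_j(2x) - Ψ_j(x)`. The gap is thus dominated by this continuous
      -- function.
      have hcont : Continuous fun x : N.PathIndex → ℝ => Ψ j (x + x) - 2 * Ψ j x := by
        have := (hΨ j).differentiable.continuous
        fun_prop
      obtain ⟨M, hM⟩ := (isCompact_feasibleFlows (N := N)).bddAbove_image hcont.continuousOn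
      refine ⟨M, ?_⟩
      rintro _ ⟨x, rfl⟩
      refine le_trans ?_ (hM ⟨x.1, x.2, rfl⟩)
      have h1 := fderiv_le_sub_of_convexOn (hΨ j).convex ((hΨ j).differentiable x.1) x.1
      rw [fderiv_apply_eq_sum_partialDeriv] at h1
      have h2 : N.totalExternality g j x = ∑ q, N.partialDeriv (Ψ j) x.1 q * x.1 q :=
        Finset.sum_congr rfl fun q _ => by rw [← (hΨ j).eq_partialDeriv x q]
      simp only [h, h2]
      linarith
    refine ⟨sSup (Set.range h), fun x => ?_, fun c hc => ?_⟩
    · have := le_csSup hbdd ⟨x, rfl⟩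
      simp only [h] at this ⊢
      linarith
    · refine csSup_le (Set.range_nonempty h) ?_
      rintro _ ⟨x, rfl⟩
      have := hc x
      simp only [h]
      linarith
  choose γ hγ using key
  exact ⟨γ, hγ⟩

theorem IsMinimalGap.respects {g : N.feasibleFlows → N.PathIndex → J → ℝ}
    {Ψ : J → (N.PathIndex → ℝ) → ℝ} {γ B : J → ℝ} (hγ : N.IsMinimalGap g Ψ γ)
    {x : N.feasibleFlows} (hx : N.IsProgramFeasible Ψ γ B x) : N.Respects g B x :=
  fun j => ((hγ j).1 x).trans (hx j)

/-- A function that is affine on the feasible flows coincides there with its tangents. -/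
theorem IsAffineOnFlows.apply_add {f : (N.PathIndex → ℝ) → ℝ} (h : N.IsAffineOnFlows f)
    {x z : N.PathIndex → ℝ} (hf : DifferentiableAt ℝ f x) (hx : x ∈ N.feasibleFlows)
    (hz : x + z ∈ N.feasibleFlows) : f (x + z) = f x + fderiv ℝ f x z := by
  obtain ⟨a, b, hab⟩ := h
  have hmem : ∀ t ∈ Set.Icc (0 : ℝ) 1, x + t • z ∈ N.feasibleFlows := by
    intro t ht
    convert convex_feasibleFlows hx hz (sub_nonneg.mpr ht.2) ht.1 (by ring) using 1
    module
  have hval : ∀ t ∈ Set.Icc (0 : ℝ) 1, f (x + t • z) = f x + t * ∑ q, a q * z q := by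
    intro t ht
    rw [hab ⟨_, hmem t ht⟩, hab ⟨_, hx⟩]
    simp only [Pi.add_apply, Pi.smul_apply, smul_eq_mul, mul_add, Finset.sum_add_distrib,
      Finset.mul_sum, mul_left_comm t]
    ring
  have h0 : (0 : ℝ) ∈ Set.Icc (0 : ℝ) 1 := by simp
  -- The affine formula is known only for `t` in `[0, 1]`, as the line may leave the polytope, so
  -- derivatives are compared within that interval.
  have h1 := (hasDerivAt_comp_line (z := z) hf).hasDerivWithinAt (s := Set.Icc 0 1)
  have h2 : HasDerivWithinAt (fun t : ℝ => f (x + t • z)) (∑ q, a q * z q) (Set.Icc 0 1) 0 := by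
    have h3 := (((hasDerivAt_id (0 : ℝ)).mul_const (∑ q, a q * z q)).const_add
      (f x)).hasDerivWithinAt (s := Set.Icc 0 1)
    rw [one_mul] at h3
    exact h3.congr (fun t ht => hval t ht) (hval 0 h0)
  have h4 := (uniqueDiffOn_Icc_zero_one 0 h0).eq_deriv _ h1 h2
  rw [h4]
  simpa using hval 1 (by simp)

theorem eventually_add_smul_mem_feasibleFlows {x z : N.PathIndex → ℝ}
    (hx : x ∈ N.feasibleFlows)
    (hz : ∀ i, ∑ p : SimplePath (N.source i) (N.sink i), z ⟨i, p⟩ = 0)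
    (hz0 : ∀ q, x q = 0 → 0 ≤ z q) :
    ∀ᶠ ε in 𝓝[>] (0 : ℝ), x + ε • z ∈ N.feasibleFlows := by
  have h : ∀ q, ∀ᶠ ε in 𝓝[>] (0 : ℝ), 0 ≤ x q + ε * z q := by
    intro q
    rcases (hx.1 q).eq_or_lt with h0 | h0
    · filter_upwards [self_mem_nhdsWithin] with ε hε
      have hε : 0 < ε := hε
      rw [← h0, zero_add]
      exact mul_nonneg hε.le (hz0 q h0.symm)
    · have hc : Continuous fun ε : ℝ => x q + ε * z q := by fun_prop
      have ht : Tendsto (fun ε : ℝ => x q + ε * z q) (𝓝 0) (𝓝 (x q)) := by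
        simpa using hc.tendsto 0
      filter_upwards [nhdsWithin_le_nhds (ht.eventually_const_lt h0)] with ε hε using hε.le
  filter_upwards [eventually_all.mpr h] with ε hε
  refine ⟨hε, fun i => ?_⟩
  simp only [Pi.add_apply, Pi.smul_apply, smul_eq_mul, Finset.sum_add_distrib,
    ← Finset.mul_sum, hz, mul_zero, add_zero, hx.2]

/-! ### First-order optimality and existence of multipliers -/

section Optimality

variable [Fintype J] {Φ : (N.PathIndex → ℝ) → ℝ} {Ψ : J → (N.PathIndex → ℝ) → ℝ} {γ B : J → ℝ}
  {x : N.feasibleFlows}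

/-- An optimal solution admits no feasible direction of descent that strictly decreases the
active non-affine constraints. -/
theorem IsProgramOptimal.fderiv_nonneg_of_strict (hx : N.IsProgramOptimal Φ Ψ γ B x)
    (hΦ : Differentiable ℝ Φ) (hΨ : ∀ j, Differentiable ℝ (Ψ j)) {z : N.PathIndex → ℝ}
    (hz : ∀ i, ∑ p : SimplePath (N.source i) (N.sink i), z ⟨i, p⟩ = 0)
    (hz0 : ∀ q, x.1 q = 0 → 0 ≤ z q)
    (hle : ∀ j, Ψ j x.1 + γ j = B j → fderiv ℝ (Ψ j) x.1 z ≤ 0)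
    (hlt : ∀ j, Ψ j x.1 + γ j = B j → ¬ N.IsAffineOnFlows (Ψ j) → fderiv ℝ (Ψ j) x.1 z < 0) :
    0 ≤ fderiv ℝ Φ x.1 z := by
  by_contra! hneg
  have hmem := eventually_add_smul_mem_feasibleFlows x.2 hz hz0
  have hcon : ∀ j, ∀ᶠ ε in 𝓝[>] (0 : ℝ), Ψ j (x.1 + ε • z) + γ j ≤ B j := by
    intro j
    rcases (hx.1 j).eq_or_lt with hj | hj
    -- Along an affine constraint there is no second-order error, so a nonpositive derivative
    -- already preserves feasibility.
    · by_cases haff : N.IsAffineOnFlows (Ψ j)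
      · filter_upwards [hmem, self_mem_nhdsWithin] with ε hε hpos
        have hpos : 0 < ε := hpos
        rw [haff.apply_add (hΨ j x.1) x.2 hε, map_smul, smul_eq_mul]
        have := mul_nonpos_of_nonneg_of_nonpos hpos.le (hle j hj)
        linarith
      · filter_upwards [eventually_lt_of_fderiv_neg (hΨ j x.1) (hlt j hj haff)] with ε hε
        linarith
    · filter_upwards [eventually_lt_of_lt (z := z) (hΨ j).continuous (lt_sub_iff_add_lt.mpr hj)]
        with ε hε
      linarith
  obtain ⟨ε, h1, h2, h3⟩ := (hmem.and ((eventually_all.mpr hcon).and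
    (eventually_lt_of_fderiv_neg (hΦ x.1) hneg))).exists
  exact absurd (hx.2 ⟨_, h1⟩ h2) (not_le.mpr h3)

/-- Slater's condition removes the strictness: `y - x` is an admissible direction along which, by
the tangent inequality, active constraints do not increase and non-affine ones strictly decrease. -/
theorem IsProgramOptimal.fderiv_nonneg (hx : N.IsProgramOptimal Φ Ψ γ B x)
    (hΦ : Differentiable ℝ Φ) (hΨ : ∀ j, Differentiable ℝ (Ψ j))
    (hΨc : ∀ j, ConvexOn ℝ Set.univ (Ψ j)) (hS : N.SlaterCondition Ψ γ B)
    {z : N.PathIndex → ℝ}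
    (hz : ∀ i, ∑ p : SimplePath (N.source i) (N.sink i), z ⟨i, p⟩ = 0)
    (hz0 : ∀ q, x.1 q = 0 → 0 ≤ z q)
    (hle : ∀ j, Ψ j x.1 + γ j = B j → fderiv ℝ (Ψ j) x.1 z ≤ 0) :
    0 ≤ fderiv ℝ Φ x.1 z := by
  obtain ⟨y, hy, hys⟩ := hS
  have htan : ∀ j, fderiv ℝ (Ψ j) x.1 (y.1 - x.1) ≤ Ψ j y.1 - Ψ j x.1 := by
    intro j
    simpa using fderiv_le_sub_of_convexOn (hΨc j) (hΨ j x.1) (y.1 - x.1)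
  have hpert : ∀ ε : ℝ, 0 < ε → 0 ≤ fderiv ℝ Φ x.1 (z + ε • (y.1 - x.1)) := by
    intro ε hε
    refine hx.fderiv_nonneg_of_strict hΦ hΨ (fun i => ?_) (fun q hq => ?_) (fun j hj => ?_)
      (fun j hj hna => ?_)
    · simp only [Pi.add_apply, Pi.smul_apply, Pi.sub_apply, smul_eq_mul,
        Finset.sum_add_distrib, ← Finset.mul_sum, Finset.sum_sub_distrib, hz, x.2.2 i, y.2.2 i,
        sub_self, mul_zero, add_zero]
    · simp only [Pi.add_apply, Pi.smul_apply, Pi.sub_apply, smul_eq_mul, hq, sub_zero]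
      exact add_nonneg (hz0 q hq) (mul_nonneg hε.le (y.2.1 q))
    · rw [map_add, map_smul, smul_eq_mul]
      refine add_nonpos (hle j hj) (mul_nonpos_of_nonneg_of_nonpos hε.le ?_)
      have := hy j
      have := htan j
      linarith
    · rw [map_add, map_smul, smul_eq_mul]
      refine add_neg_of_nonpos_of_neg (hle j hj) (mul_neg_of_pos_of_neg hε ?_)
      have := hys j hna
      have := htan j
      linarith
  have hc : Continuous fun ε : ℝ => fderiv ℝ Φ x.1 (z + ε • (y.1 - x.1)) := by fun_prop
  have ht : Tendsto (fun ε : ℝ => fderiv ℝ Φ x.1 (z + ε • (y.1 - x.1))) (𝓝[>] 0)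
      (𝓝 (fderiv ℝ Φ x.1 z)) := by
    simpa using (hc.tendsto 0).mono_left nhdsWithin_le_nhds
  exact ge_of_tendsto ht (by filter_upwards [self_mem_nhdsWithin] with ε hε using hpert ε hε)

/-- Under Slater's condition every optimal solution has optimal Lagrange multipliers. -/
theorem IsProgramOptimal.exists_isLagrangeMultiplier (hx : N.IsProgramOptimal Φ Ψ γ B x)
    (hΦ : Differentiable ℝ Φ) (hΨ : ∀ j, Differentiable ℝ (Ψ j))
    (hΨc : ∀ j, ConvexOn ℝ Set.univ (Ψ j)) (hS : N.SlaterCondition Ψ γ B) :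
    ∃ lam : J → ℝ, N.IsLagrangeMultiplier Φ Ψ γ B x lam := by
  classical
  let dem : I → (N.PathIndex → ℝ) →ₗ[ℝ] ℝ := fun i =>
    ∑ p : SimplePath (N.source i) (N.sink i), LinearMap.proj ⟨i, p⟩
  have hdem : ∀ i w, dem i w = ∑ p : SimplePath (N.source i) (N.sink i), w ⟨i, p⟩ := by
    intro i w
    simp [dem, LinearMap.sum_apply]
  -- Inactive constraints are replaced by the zero form, which keeps the index set fixed; their
  -- multipliers are reset to 0 below, giving complementary slackness.
  let act : J → (N.PathIndex → ℝ) →ₗ[ℝ] ℝ := fun j =>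
    if Ψ j x.1 + γ j = B j then (fderiv ℝ (Ψ j) x.1).toLinearMap else 0
  let bd : N.PathIndex → (N.PathIndex → ℝ) →ₗ[ℝ] ℝ := fun q =>
    if x.1 q = 0 then -LinearMap.proj q else 0
  -- Each demand equation enters as two opposite inequalities, so `nu` is a difference of two
  -- nonnegative coefficients and its sign is free.
  let a : J ⊕ N.PathIndex ⊕ I ⊕ I → (N.PathIndex → ℝ) →ₗ[ℝ] ℝ :=
    Sum.elim act (Sum.elim bd (Sum.elim dem (-dem)))
  obtain ⟨l, hl, hb⟩ := exists_nonneg_sum_smul_of_forall_nonpos Finset.univ a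
    (-(fderiv ℝ Φ x.1).toLinearMap) (fun w hw => by
      have h := hx.fderiv_nonneg hΦ hΨ hΨc hS (z := w) (fun i => ?_) (fun q hq => ?_)
        (fun j hj => ?_)
      · simpa using h
      · have h1 := hw (Sum.inr (Sum.inr (Sum.inl i))) (Finset.mem_univ _)
        have h2 := hw (Sum.inr (Sum.inr (Sum.inr i))) (Finset.mem_univ _)
        simp only [a, Sum.elim_inl, Sum.elim_inr, Pi.neg_apply, LinearMap.neg_apply, hdem]
          at h1 h2
        linarith
      · simpa [a, bd, hq] using hw (Sum.inr (Sum.inl q)) (Finset.mem_univ _)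
      · simpa [a, act, hj] using hw (Sum.inl j) (Finset.mem_univ _))
  refine ⟨fun j => if Ψ j x.1 + γ j = B j then l (Sum.inl j) else 0,
    fun q => if x.1 q = 0 then l (Sum.inr (Sum.inl q)) else 0,
    fun i => l (Sum.inr (Sum.inr (Sum.inl i))) - l (Sum.inr (Sum.inr (Sum.inr i))),
    hx.1, fun j => ?_, fun q => ?_, fun j => ?_, fun q => ?_, fun q => ?_⟩
  · split_ifs
    exacts [hl _, le_rfl]
  · split_ifs
    exacts [hl _, le_rfl]
  · split_ifs with h
    · rw [h, sub_self, mul_zero]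
    · exact zero_mul _
  · split_ifs with h
    · rw [h, mul_zero]
    · exact zero_mul _
  -- Stationarity is the Farkas identity evaluated at the basis vector of `q`.
  · have hq := congrArg (fun f : (N.PathIndex → ℝ) →ₗ[ℝ] ℝ => f (Pi.single q 1)) hb
    simp only [LinearMap.neg_apply, LinearMap.sum_apply, LinearMap.smul_apply, smul_eq_mul] at hq
    simp only [Fintype.sum_sum_type, LinearMap.neg_apply, a, Sum.elim_inl, Sum.elim_inr, Pi.neg_apply] at hq
    have hact : ∀ j, l (Sum.inl j) * act j (Pi.single q 1)
        = (if Ψ j x.1 + γ j = B j then l (Sum.inl j) else 0) * N.partialDeriv (Ψ j) x.1 q := by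
      intro j
      by_cases h : Ψ j x.1 + γ j = B j
      · simp only [act, h, if_true]
        congr!
      · simp [act, h]
    have hbd : ∑ r, l (Sum.inr (Sum.inl r)) * bd r (Pi.single q 1)
        = -(if x.1 q = 0 then l (Sum.inr (Sum.inl q)) else 0) := by
      rw [Finset.sum_eq_single q]
      · by_cases h : x.1 q = 0 <;> simp [bd, h]
      · intro r _ hr
        by_cases h : x.1 r = 0 <;> simp [bd, h, hr]
      · simp
    have hsingle : ∀ i, dem i (Pi.single q 1) = if i = q.1 then 1 else 0 := by
      intro i
      rw [hdem]
      obtain ⟨k, p⟩ := q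
      by_cases h : i = k
      · subst h
        rw [Finset.sum_eq_single p]
        · simp
        · intro r _ hr
          simp [hr]
        · simp
      · simp [h]
    simp only [hact, hbd, hsingle, mul_ite, mul_one, mul_zero, mul_neg, Finset.sum_neg_distrib,
      Finset.sum_ite_eq', Finset.mem_univ, if_true] at hq
    have hΦq : (fderiv ℝ Φ x.1).toLinearMap (Pi.single q 1) = N.partialDeriv Φ x.1 q := by
      unfold partialDeriv
      congr!
    rw [hΦq] at hq
    linarith

end Optimality

end Traffic.Commodities

theorem mainTheorem3 {V : Type*} [Quiver V] [Finite V] [∀ a b : V, Finite (a ⟶ b)]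
    {I : Type*} [Fintype I] {J : Type*} [Fintype J]
    (N : Traffic.Commodities V I)
    (τ : N.feasibleFlows → N.PathIndex → ℝ)
    (g : N.feasibleFlows → N.PathIndex → J → ℝ) (hg : ∀ x q j, 0 ≤ g x q j)
    (Φ : (N.PathIndex → ℝ) → ℝ) (hΦ : N.IsConvexPotential τ Φ)
    (Ψ : J → (N.PathIndex → ℝ) → ℝ)
    (hΨ : ∀ j, N.IsConvexPotential (fun x q => g x q j) (Ψ j))
    (B : J → ℝ) (hB : ∀ j, 0 ≤ B j) (hBfeas : N.IsFeasibleBudget g B) :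
    -- the minimal constants exist
    (∃ γ : J → ℝ, N.IsMinimalGap g Ψ γ) ∧
    ∀ γ : J → ℝ, N.IsMinimalGap g Ψ γ →
      -- optimal solutions respect the budget, and optimal Lagrange multipliers implement them
      (∀ x : N.feasibleFlows, N.IsProgramOptimal Φ Ψ γ B x →
        N.Respects g B x ∧
        ∀ lam : J → ℝ, N.IsLagrangeMultiplier Φ Ψ γ B x lam → x ∈ N.WE τ g lam) ∧
      -- under the constraint qualification, optimal Lagrange multipliers exist, so every optimal
      -- solution is implementable, and the budget is implementable if there is a solution
      (N.SlaterCondition Ψ γ B →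
        (∀ x : N.feasibleFlows, N.IsProgramOptimal Φ Ψ γ B x →
          (∃ lam : J → ℝ, N.IsLagrangeMultiplier Φ Ψ γ B x lam ∧ x ∈ N.WE τ g lam) ∧
          N.IsImplementableFlow τ g x) ∧
        ((∃ x : N.feasibleFlows, N.IsProgramOptimal Φ Ψ γ B x) →
          N.IsImplementableBudget τ g B)) := by

  -- A feasible flow is needed for `γ`: over an empty set every real is an admissible constant and
  -- none is least.
  obtain ⟨x₀, -⟩ := hBfeas
  refine ⟨Traffic.Commodities.exists_isMinimalGap ⟨x₀⟩ hΨ, fun γ hγ =>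
    ⟨fun x hx => ⟨hγ.respects hx.1, fun lam h => h.mem_WE hΦ hΨ⟩, fun hS => ?_⟩⟩
  have hopt : ∀ x : N.feasibleFlows, N.IsProgramOptimal Φ Ψ γ B x →
      (∃ lam : J → ℝ, N.IsLagrangeMultiplier Φ Ψ γ B x lam ∧ x ∈ N.WE τ g lam) ∧
        N.IsImplementableFlow τ g x := by
    intro x hx
    obtain ⟨lam, h⟩ := hx.exists_isLagrangeMultiplier hΦ.differentiable
      (fun j => (hΨ j).differentiable) (fun j => (hΨ j).convex) hS
    have hWE := h.mem_WE hΦ hΨ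
    obtain ⟨mu, nu, hk⟩ := h
    exact ⟨⟨lam, ⟨mu, nu, hk⟩, hWE⟩, lam, hk.lam_nonneg, hWE⟩
  exact ⟨hopt, fun ⟨x, hx⟩ => ⟨x, (hopt x hx).2, hγ.respects hx.1⟩⟩
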